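/- Consider one-sided online bipartite matching. An instance $I$ of size $n$ is a finite bipartite graph with $n$ online vertices and an arbitrary finite number of offline vertices; $v(I)$ denotes the size of a maximum matching. The online vertices arrive one after the other, each together with the set of its offline neighbours. The algorithm Random matches each arriving vertex to one of its neighbours that are not yet matched, chosen uniformly at random, and leaves it unmatched if there is no such neighbour; its choices are irrevocable. For $\sigma\in S_n$ let $v(\mathrm{Random}, I(\sigma))$ be the expected size of the matching that Random constructs when the online vertices of $I$ arrive in the order given by $\sigma$. Theorem. In the random order model, where $\sigma\in S_n$ is chosen uniformly at random, the asymptotic approximation ratio of Random is at most $3/4$, that is, $$\liminf_{n\to\infty}\ \inf_{I}\ \frac{\mathbb{E}_{\sigma\in S_n}\left[v(\mathrm{Random}, I(\sigma))\right]}{v(I)}\ \le\ \frac34,$$ where the infimum is over all instances $I$ of size $n$ with $v(I)>0$. -/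

import Mathlib

open scoped ENNReal

namespace OnlineMatching

/-- An instance of one-sided online bipartite matching with `n` online vertices (the data items)
and an arbitrary finite number `m` of offline vertices: every online vertex has a set of offline
neighbours. The size of the instance is its number `n` of data items. -/
structure Instance (n : ℕ) where
  /-- the number of offline vertices -/
  m : ℕ
  /-- the neighbourhood of an online vertex -/
  nbr : Fin n → Finset (Fin m)

/-- A set of edges is a matching if it consists of edges of the graph and no two of them share
an online or an offline vertex. -/
def Instance.IsMatching {n : ℕ} (I : Instance n) (S : Finset (Fin n × Fin I.m)) : Prop :=
  (∀ e ∈ S, e.2 ∈ I.nbr e.1) ∧ ∀ e ∈ S, ∀ f ∈ S, e ≠ f → e.1 ≠ f.1 ∧ e.2 ≠ f.2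

open Classical in
/-- The optimal value of an instance: the size of a maximum matching. -/
noncomputable def Instance.opt {n : ℕ} (I : Instance n) : ℕ :=
  ((Finset.univ : Finset (Finset (Fin n × Fin I.m))).filter I.IsMatching).sup Finset.card

/-- A data item: an online vertex together with the set of all its offline neighbours. -/
abbrev DataItem (n m : ℕ) : Type := Fin n × Finset (Fin m)

/-- The data items processed so far, in order of arrival, each with the decision taken for it:
`some v` if it was matched to the offline vertex `v`, `none` if it was left unmatched. -/
abbrev History (n m : ℕ) : Type := List (DataItem n m × Option (Fin m))

/-- The vertices of `N` to which no earlier online vertex has been matched. -/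
def available {n m : ℕ} (h : History n m) (N : Finset (Fin m)) : Finset (Fin m) :=
  N.filter fun v => ∀ e ∈ h, e.2 ≠ some v

/-- The number of online vertices that have been matched. -/
def matchedCount {n m : ℕ} (h : History n m) : ℕ :=
  h.countP fun e => e.2.isSome

/-- A (randomized) online algorithm: given all previously seen data items with the decisions taken
for them, and the data item that has just arrived, it chooses (at random) a decision, and an online
vertex can be matched only to one of its unmatched neighbours. -/
structure Algorithm where
  /-- the distribution of the decision for the data item that has just arrived -/
  decision : ∀ {n m : ℕ}, History n m → DataItem n m → PMF (Option (Fin m))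
  legal : ∀ {n m : ℕ} (h : History n m) (d : DataItem n m) (v : Fin m),
    some v ∈ (decision h d).support → v ∈ available h d.2

/-- The distribution of the final history when the algorithm, having reached the history `h`,
processes the given list of data items one after the other. -/
noncomputable def Algorithm.run (A : Algorithm) {n m : ℕ} :
    List (DataItem n m) → History n m → PMF (History n m)
  | [], h => PMF.pure h
  | d :: ds, h => (A.decision h d).bind fun o => A.run ds (h ++ [(d, o)])

/-- The data items of `I` in the order dictated by the permutation `σ`. -/
def Instance.arrivals {n : ℕ} (I : Instance n) (σ : Equiv.Perm (Fin n)) :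
    List (DataItem n I.m) :=
  List.ofFn fun t => (σ t, I.nbr (σ t))

/-- The expected size (over the random choices of the algorithm) of the matching that the algorithm
constructs when the data items of `I` arrive in the order `σ`. -/
noncomputable def Algorithm.value (A : Algorithm) {n : ℕ} (I : Instance n)
    (σ : Equiv.Perm (Fin n)) : ℝ≥0∞ :=
  ∑' h : History n I.m, A.run (I.arrivals σ) [] h * (matchedCount h : ℝ≥0∞)

/-- The expected value in the random order model: the arrival order is a uniformly random
permutation of the data items. -/
noncomputable def Algorithm.romValue (A : Algorithm) {n : ℕ} (I : Instance n) : ℝ≥0∞ :=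
  (∑ σ : Equiv.Perm (Fin n), A.value I σ) / (n.factorial : ℝ≥0∞)

/-- The asymptotic approximation ratio in the random order model: the limit inferior, as the size
`n` tends to infinity, of the infimum over all instances of size `n` of the expected value divided
by the optimal value. Instances with optimal value `0` (graphs without edges) have no ratio. -/
noncomputable def Algorithm.romAsymptoticRatio (A : Algorithm) : ℝ≥0∞ :=
  Filter.liminf
    (fun n : ℕ => ⨅ (I : Instance n) (_ : 0 < I.opt), A.romValue I / (I.opt : ℝ≥0∞))
    Filter.atTop

/-- The algorithm Random: match the arriving vertex to one of its unmatched neighbours, chosen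
uniformly at random; leave it unmatched if there is none. -/
noncomputable def random : Algorithm where
  decision h d :=
    if hne : (available h d.2).Nonempty then (PMF.uniformOfFinset (available h d.2) hne).map some
    else PMF.pure none
  legal h d v hv := by
    split_ifs at hv with hne
    · simpa using hv
    · simp at hv

end OnlineMatching

namespace OnlineMatching

/-! ### The expected number of matched vertices as a real-valued recursion -/

/-! The hard graph joins every common online vertex to its own private offline vertex and to the
whole core; every private online vertex sees a single core vertex. The edges i–i form a perfect
matching of size `p + N`. Random, however, sends a common vertex into a core with `f` free vertices
with probability at least f/(f+1), and each such choice may block a private vertex. With `p` close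
to `N`, only about half of the private vertices survive, giving about N + N/2 out of 2N.

The precise argument is a supermartingale-type bound with a potential. While the remaining common
vertices `a` outnumber the free core vertices `f`, the core loses at least about one vertex to a
common arrival for each private match, so f/2 bounds the future private matches. Two corrections are
needed. A common vertex taking its own neighbour lets `f` catch up with `a`; the excess term charges
at most `c` for this, and the drop of `c * harmonic f` at the other common arrivals pays for it.
Once `f` has caught up, the excess term has grown so large that the minimum in `potential` is the
trivial bound `f`. The drift inequality is `potential_step`; `totalMatched_le` turns it into a bound
for all orders, and `potential_balanced_le` shows the corrections to be of lower order. -/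

/-- The expected final number of matched online vertices when Random processes a list of data
items after having reached a given history. -/
noncomputable def expectedMatched {n m : ℕ} : List (DataItem n m) → History n m → ℝ
  | [], h => matchedCount h
  | d :: ds, h =>
      if (available h d.2).Nonempty then
        (∑ v ∈ available h d.2, expectedMatched ds (h ++ [(d, some v)])) / (available h d.2).card
      else expectedMatched ds (h ++ [(d, none)])

theorem expectedMatched_nonneg {n m : ℕ} (l : List (DataItem n m)) (h : History n m) :
    0 ≤ expectedMatched l h := by
  induction l generalizing h with
  | nil => simp [expectedMatched]
  | cons d ds ih =>
    rw [expectedMatched]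
    split_ifs
    · exact div_nonneg (Finset.sum_nonneg fun v _ => ih _) (Nat.cast_nonneg _)
    · exact ih _

theorem tsum_bind_mul {α β : Type*} (p : PMF α) (q : α → PMF β) (f : β → ℝ≥0∞) :
    ∑' b, (p.bind q) b * f b = ∑' a, p a * ∑' b, q a b * f b := by
  simp_rw [PMF.bind_apply, ← ENNReal.tsum_mul_right, ← ENNReal.tsum_mul_left]
  rw [ENNReal.tsum_comm]
  simp_rw [mul_assoc]

theorem tsum_pure_mul {β : Type*} (a : β) (f : β → ℝ≥0∞) :
    ∑' b, PMF.pure a b * f b = f a := by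
  rw [tsum_eq_single a]
  · simp
  · intro b hb
    simp [hb]

theorem tsum_uniformOfFinset_mul {α : Type*} (s : Finset α) (hs : s.Nonempty) (f : α → ℝ≥0∞) :
    ∑' a, PMF.uniformOfFinset s hs a * f a = (∑ a ∈ s, f a) / s.card := by
  rw [tsum_eq_sum (s := s) (fun b hb => by simp [PMF.uniformOfFinset_apply, hb])]
  rw [ENNReal.div_eq_inv_mul, Finset.mul_sum]
  exact Finset.sum_congr rfl fun a ha => by simp [PMF.uniformOfFinset_apply, ha]

/-- Moves the problem from `ℝ≥0∞` to `ℝ`, where differences of potentials make sense. -/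
theorem tsum_run_random_mul {n m : ℕ} (l : List (DataItem n m)) (h : History n m) :
    ∑' h' : History n m, random.run l h h' * (matchedCount h' : ℝ≥0∞) =
      ENNReal.ofReal (expectedMatched l h) := by
  induction l generalizing h with
  | nil => simp only [Algorithm.run, tsum_pure_mul, expectedMatched, ENNReal.ofReal_natCast]
  | cons d ds ih =>
    rw [Algorithm.run, tsum_bind_mul, expectedMatched]
    simp_rw [ih]
    by_cases hne : (available h d.2).Nonempty
    · have hdec : random.decision h d =
          (PMF.uniformOfFinset (available h d.2) hne).map some := by simp [random, hne]
      rw [hdec, if_pos hne, PMF.map, tsum_bind_mul]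
      simp_rw [Function.comp_apply, tsum_pure_mul]
      rw [tsum_uniformOfFinset_mul,
        ENNReal.ofReal_div_of_pos (by exact_mod_cast hne.card_pos),
        ENNReal.ofReal_sum_of_nonneg fun v _ => expectedMatched_nonneg _ _,
        ENNReal.ofReal_natCast]
    · have hdec : random.decision h d = PMF.pure none := by simp [random, hne]
      rw [hdec, if_neg hne, tsum_pure_mul]

theorem romValue_random {n : ℕ} (I : Instance n) :
    random.romValue I = ENNReal.ofReal
      ((∑ σ : Equiv.Perm (Fin n), expectedMatched (I.arrivals σ) []) / n.factorial) := by
  rw [Algorithm.romValue, ENNReal.ofReal_div_of_pos (by exact_mod_cast n.factorial_pos),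
    ENNReal.ofReal_sum_of_nonneg fun σ _ => expectedMatched_nonneg _ _, ENNReal.ofReal_natCast]
  simp_rw [Algorithm.value, tsum_run_random_mul]

/-! ### Summation over the arrival orders -/

/-- The sequence that is left when the entry at position `t` is removed; the first entry takes
its place. -/
def removeAt {α : Type*} {k : ℕ} (s : Fin (k + 1) → α) (t : Fin (k + 1)) : Fin k → α :=
  fun i => s (Equiv.swap 0 t i.succ)

theorem removeAt_injective {α : Type*} {k : ℕ} {s : Fin (k + 1) → α} (hs : s.Injective)
    (t : Fin (k + 1)) : (removeAt s t).Injective :=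
  hs.comp ((Equiv.swap 0 t).injective.comp (Fin.succ_injective k))

theorem sum_removeAt {α M : Type*} [AddCommMonoid M] {k : ℕ} (s : Fin (k + 1) → α)
    (t : Fin (k + 1)) (F : α → M) : F (s t) + ∑ i, F (removeAt s t i) = ∑ i, F (s i) := by
  rw [← Equiv.sum_comp (Equiv.swap 0 t) fun i => F (s i), Fin.sum_univ_succ]
  simp [removeAt]

/-- Conditioning on the first arrival `t`: `decomposeFin` splits a permutation into `t` and an order
of the rest, and the swap in `removeAt` is the one it uses. -/
theorem sum_perm_ofFn {α M : Type*} [AddCommMonoid M] {k : ℕ} (s : Fin (k + 1) → α)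
    (F : List α → M) :
    ∑ σ : Equiv.Perm (Fin (k + 1)), F (List.ofFn fun i => s (σ i)) =
      ∑ t, ∑ τ : Equiv.Perm (Fin k), F (s t :: List.ofFn fun i => removeAt s t (τ i)) := by
  rw [← Equiv.sum_comp Equiv.Perm.decomposeFin.symm, Fintype.sum_prod_type]
  refine Finset.sum_congr rfl fun t _ => Finset.sum_congr rfl fun τ _ => ?_
  rw [List.ofFn_succ]
  simp only [Equiv.Perm.decomposeFin_symm_apply_zero, Equiv.Perm.decomposeFin_symm_apply_succ,
    removeAt]

/-- The sum, over all arrival orders of a sequence of data items, of the expected final number of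
matched online vertices. -/
noncomputable def totalMatched {n m k : ℕ} (s : Fin k → DataItem n m) (h : History n m) : ℝ :=
  ∑ σ : Equiv.Perm (Fin k), expectedMatched (List.ofFn fun i => s (σ i)) h

theorem totalMatched_zero {n m : ℕ} (s : Fin 0 → DataItem n m) (h : History n m) :
    totalMatched s h = matchedCount h := by
  simp [totalMatched, expectedMatched]

theorem totalMatched_succ {n m k : ℕ} (s : Fin (k + 1) → DataItem n m) (h : History n m) :
    totalMatched s h = ∑ t,
      if (available h (s t).2).Nonempty then
        (∑ v ∈ available h (s t).2, totalMatched (removeAt s t) (h ++ [(s t, some v)])) /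
          (available h (s t).2).card
      else totalMatched (removeAt s t) (h ++ [(s t, none)]) := by
  rw [totalMatched, sum_perm_ofFn s fun l => expectedMatched l h]
  refine Finset.sum_congr rfl fun t _ => ?_
  simp only [expectedMatched]
  split_ifs
  · rw [← Finset.sum_div, Finset.sum_comm]
    rfl
  · rfl

/-! ### Histories -/

theorem available_append_some {n m : ℕ} (h : History n m) (d : DataItem n m) (v : Fin m)
    (N : Finset (Fin m)) : available (h ++ [(d, some v)]) N = (available h N).erase v := by
  ext w
  simp only [available, Finset.mem_filter, Finset.mem_erase, List.mem_append, List.mem_singleton]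
  constructor
  · rintro ⟨hw, H⟩
    exact ⟨fun e => H (d, some v) (Or.inr rfl) (by rw [e]), hw, fun e he => H e (Or.inl he)⟩
  · rintro ⟨hne, hw, H⟩
    refine ⟨hw, ?_⟩
    rintro e (he | rfl)
    · exact H e he
    · simpa using Ne.symm hne

theorem available_append_none {n m : ℕ} (h : History n m) (d : DataItem n m)
    (N : Finset (Fin m)) : available (h ++ [(d, none)]) N = available h N := by
  ext w
  simp only [available, Finset.mem_filter, List.mem_append, List.mem_singleton]
  constructor
  · rintro ⟨hw, H⟩
    exact ⟨hw, fun e he => H e (Or.inl he)⟩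
  · rintro ⟨hw, H⟩
    refine ⟨hw, ?_⟩
    rintro e (he | rfl)
    · exact H e he
    · simp

theorem matchedCount_append_some {n m : ℕ} (h : History n m) (d : DataItem n m) (v : Fin m) :
    matchedCount (h ++ [(d, some v)]) = matchedCount h + 1 := by
  simp [matchedCount]

theorem matchedCount_append_none {n m : ℕ} (h : History n m) (d : DataItem n m) :
    matchedCount (h ++ [(d, none)]) = matchedCount h := by
  simp [matchedCount]

/-! ### The potential -/

/-- The nontrivial term of the potential: half of the `f` free core vertices, and a penalty that
grows with the excess of `f` over the number `a` of remaining common online vertices. -/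
noncomputable def potentialAux (k c : ℝ) (a f : ℕ) : ℝ :=
  f / 2 + c * (max (f + 1 - a + k) 0 + harmonic f)

/-- The potential: it bounds the expected number of private online vertices that are still going
to be matched when `a` common online vertices are to come and `f` core offline vertices are free. -/
noncomputable def potential (k c : ℝ) (a f : ℕ) : ℝ :=
  min f (potentialAux k c a f)

theorem harmonic_cast_nonneg (f : ℕ) : (0 : ℝ) ≤ harmonic f := by
  have : (0 : ℚ) ≤ harmonic f := Finset.sum_nonneg fun i _ => by positivity
  exact_mod_cast this

theorem potential_nonneg {k c : ℝ} (hc : 0 ≤ c) (a f : ℕ) : 0 ≤ potential k c a f := by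
  have := harmonic_cast_nonneg f
  exact le_min (Nat.cast_nonneg _) (by unfold potentialAux; positivity)

theorem potential_le_natCast (k c : ℝ) (a f : ℕ) : potential k c a f ≤ f := min_le_left _ _

theorem potential_zero_right {k c : ℝ} (hc : 0 ≤ c) (a : ℕ) : potential k c a 0 = 0 :=
  le_antisymm (by simpa using potential_le_natCast k c a 0) (potential_nonneg hc a 0)

theorem potential_zero_left {k c : ℝ} (hc : 0 ≤ c) {f : ℕ} (hf : (f : ℝ) / 2 ≤ c * k) :
    potential k c 0 f = f := by
  refine min_eq_left ?_
  have h1 := le_max_left ((f : ℝ) + 1 - (0 : ℕ) + k) 0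
  have h2 := harmonic_cast_nonneg f
  have h3 : (0 : ℝ) ≤ f := Nat.cast_nonneg f
  rw [Nat.cast_zero] at h1
  unfold potentialAux
  rw [Nat.cast_zero]
  have h4 := mul_le_mul_of_nonneg_left
    (show k ≤ max ((f : ℝ) + 1 - 0 + k) 0 + harmonic f by linarith) hc
  linarith

theorem potential_mono {k c : ℝ} (hc : 0 ≤ c) (a f : ℕ) :
    potential k c a f ≤ potential k c a (f + 1) := by
  have h1 : (harmonic (f + 1) : ℝ) = harmonic f + ((f : ℝ) + 1)⁻¹ := by
    rw [harmonic_succ]; push_cast; ring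
  refine min_le_min (by gcongr; linarith) ?_
  unfold potentialAux
  rw [h1]
  have : (0 : ℝ) ≤ ((f : ℝ) + 1)⁻¹ := by positivity
  gcongr <;> linarith

/-- The expected decrease of the potential pays for the private online vertices. -/
theorem potential_step {k c : ℝ} (hc : 0 ≤ c) {a f g : ℕ}
    (hf : ((f : ℝ) + 1) / 2 ≤ c * k) (hg : g ≤ f + 1) :
    g * (1 + potential k c (a + 1) f - potential k c (a + 1) (f + 1)) ≤
      (a + 1) * (potential k c (a + 1) (f + 1) -
        ((f + 1) * potential k c a f + potential k c a (f + 1)) / (f + 2)) := by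
  have hg' : (g : ℝ) ≤ f + 1 := by exact_mod_cast hg
  have hf0 : (0 : ℝ) ≤ f := Nat.cast_nonneg f
  have ha0 : (0 : ℝ) ≤ a := Nat.cast_nonneg a
  have hg0 : (0 : ℝ) ≤ g := Nat.cast_nonneg g
  have hh : (harmonic (f + 1) : ℝ) = harmonic f + ((f : ℝ) + 1)⁻¹ := by
    rw [harmonic_succ]; push_cast; ring
  have hinv : (0 : ℝ) ≤ ((f : ℝ) + 1)⁻¹ := by positivity
  have hH := harmonic_cast_nonneg f
  rcases le_or_gt ((f + 1 : ℕ) : ℝ) (potentialAux k c (a + 1) (f + 1)) with hle | hle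
  -- Where the trivial bound is active, each private match uses up a free core vertex, and no
  -- arrival raises the potential.
  · have e1 : potential k c (a + 1) (f + 1) = f + 1 := by
      rw [potential, min_eq_left hle]; push_cast; ring
    have h1 := potential_le_natCast k c (a + 1) f
    have h2 := potential_le_natCast k c a f
    have h3 := potential_le_natCast k c a (f + 1)
    push_cast at h3
    rw [e1]
    refine le_trans (mul_nonpos_of_nonneg_of_nonpos hg0 (by linarith)) ?_
    refine mul_nonneg (by linarith) (sub_nonneg.2 ?_)
    rw [div_le_iff₀ (by linarith)]
    nlinarith
  · have e1 : potential k c (a + 1) (f + 1) = potentialAux k c (a + 1) (f + 1) :=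
      min_eq_right hle.le
    -- Otherwise the excess term alone is at least `c * (1 + k)`, which with `hf` would make the
    -- trivial bound active.
    have hD : (f : ℝ) + 1 ≤ a := by
      by_contra hcon
      have hcon : (a : ℝ) + 1 ≤ f + 1 := by
        have : a < f + 1 := by exact_mod_cast not_le.1 hcon
        exact_mod_cast this
      have : (f + 1 : ℝ) / 2 + c * (1 + k) ≤ potentialAux k c (a + 1) (f + 1) := by
        have h1 := le_max_left ((f : ℝ) + 1 + 1 - (a + 1) + k) 0
        have h2 := harmonic_cast_nonneg (f + 1)
        have h3 := mul_le_mul_of_nonneg_left (show 1 + k ≤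
          max ((f : ℝ) + 1 + 1 - (a + 1) + k) 0 + harmonic (f + 1) by linarith) hc
        unfold potentialAux
        push_cast
        linarith
      push_cast at hle
      linarith
    have h2 : potential k c (a + 1) f ≤ potentialAux k c (a + 1) (f + 1) - 1 / 2 := by
      refine (min_le_right _ _).trans ?_
      unfold potentialAux
      rw [hh]
      have : max ((f : ℝ) + 1 - (a + 1 : ℕ) + k) 0 ≤ max (((f + 1 : ℕ) : ℝ) + 1 - (a + 1 : ℕ) + k) 0 :=
        max_le_max (by push_cast; linarith) le_rfl
      have := mul_le_mul_of_nonneg_left this hc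
      have := mul_nonneg hc hinv
      push_cast at *
      linarith
    have h3 : potential k c a f ≤
        potentialAux k c (a + 1) (f + 1) - 1 / 2 - c * ((f : ℝ) + 1)⁻¹ := by
      refine (min_le_right _ _).trans (le_of_eq ?_)
      unfold potentialAux
      rw [hh]
      have : (f : ℝ) + 1 - a + k = ((f + 1 : ℕ) : ℝ) + 1 - (a + 1 : ℕ) + k := by
        push_cast; ring
      rw [this]
      push_cast
      ring
    have h4 : potential k c a (f + 1) ≤ potentialAux k c (a + 1) (f + 1) + c := by
      refine (min_le_right _ _).trans ?_
      unfold potentialAux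
      have : max (((f + 1 : ℕ) : ℝ) + 1 - a + k) 0 ≤
          max (((f + 1 : ℕ) : ℝ) + 1 - (a + 1 : ℕ) + k) 0 + 1 := by
        refine max_le ?_ (by positivity)
        have := le_max_left (((f + 1 : ℕ) : ℝ) + 1 - (a + 1 : ℕ) + k) 0
        push_cast at *
        linarith
      have := mul_le_mul_of_nonneg_left this hc
      linarith
    rw [e1]
    generalize potentialAux k c (a + 1) (f + 1) = P at *
    -- The possible loss `c`, of weight 1/(f+2), cancels against the harmonic gain c/(f+1), of
    -- weight (f+1)/(f+2); only the drop 1/2 of the linear term remains.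
    have h5 : ((f : ℝ) + 1) / (2 * (f + 2)) ≤
        P - ((f + 1) * potential k c a f + potential k c a (f + 1)) / (f + 2) := by
      have : ((f : ℝ) + 1) * potential k c a f ≤ (f + 1) * (P - 1 / 2) - c := by
        refine (mul_le_mul_of_nonneg_left h3 (by linarith)).trans (le_of_eq ?_)
        field_simp
      rw [le_sub_iff_add_le, ← div_div, ← add_div, div_le_iff₀ (by linarith)]
      linarith
    calc (g : ℝ) * (1 + potential k c (a + 1) f - P) ≤ g * (1 / 2) := by gcongr; linarith
      _ ≤ (f + 1) * (1 / 2) := by gcongr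
      _ = (f + 2) * ((f + 1) / (2 * (f + 2))) := by field_simp
      -- By `hD`, at least f + 2 common vertices remain.
      _ ≤ (a + 1) * ((f + 1) / (2 * (f + 2))) := by gcongr ?_ * _; linarith
      _ ≤ _ := by gcongr

/-! ### The hard instances -/

/-- The instance with `p` common and `N` private online vertices. Offline vertex `i` is adjacent to
online vertex `i`, and the offline vertices `j` with `p ≤ j`, which form the core, are moreover
adjacent to all common online vertices. -/
def coreInstance (p N : ℕ) : Instance (p + N) where
  m := p + N
  nbr i := Finset.univ.filter fun j => j = i ∨ (i.val < p ∧ p ≤ j.val)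

/-- The core of `coreInstance p N`. -/
def core (p N : ℕ) : Finset (Fin (p + N)) := Finset.univ.filter fun j => p ≤ j.val

/-- The data item of an online vertex of `coreInstance p N`. -/
def coreItem (p N : ℕ) (i : Fin (p + N)) : DataItem (p + N) (p + N) :=
  (i, (coreInstance p N).nbr i)

/-- The number of common online vertices in a sequence. -/
def commonCount (p N : ℕ) {K : ℕ} (s : Fin K → Fin (p + N)) : ℕ :=
  ∑ t, if (s t).val < p then 1 else 0

theorem card_core (p N : ℕ) : (core p N).card = N := by
  have : core p N = Finset.univ.map (Fin.natAddEmb p) := by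
    ext j
    simp only [core, Finset.mem_filter, Finset.mem_univ, true_and, Finset.mem_map]
    constructor
    · intro hj
      exact ⟨⟨j - p, by omega⟩, by ext; simp; omega⟩
    · rintro ⟨i, rfl⟩
      simp
  rw [this, Finset.card_map, Finset.card_univ, Fintype.card_fin]

theorem commonCount_id (p N : ℕ) : commonCount p N (fun i => i) = p := by
  rw [commonCount, Fin.sum_univ_add]
  simp

theorem mem_nbr_self {p N : ℕ} (i : Fin (p + N)) : i ∈ (coreInstance p N).nbr i :=
  Finset.mem_filter.2 ⟨Finset.mem_univ _, Or.inl rfl⟩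

theorem le_opt_coreInstance (p N : ℕ) : p + N ≤ (coreInstance p N).opt := by
  let S : Finset (Fin (p + N) × Fin (coreInstance p N).m) :=
    Finset.univ.map ⟨fun i : Fin (p + N) => (i, i), fun i j h => (Prod.mk.inj h).1⟩
  have hS : S.card = p + N := by simp [S]
  have hM : (coreInstance p N).IsMatching S := by
    constructor
    · intro e he
      obtain ⟨i, -, rfl⟩ := Finset.mem_map.1 he
      exact mem_nbr_self i
    · intro e he f hf hne
      obtain ⟨i, -, rfl⟩ := Finset.mem_map.1 he
      obtain ⟨j, -, rfl⟩ := Finset.mem_map.1 hf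
      have : i ≠ j := fun hij => hne (by rw [hij])
      exact ⟨this, this⟩
  refine hS.symm.trans_le ?_
  unfold Instance.opt
  classical
  exact Finset.le_sup (f := Finset.card) (Finset.mem_filter.2 ⟨Finset.mem_univ _, hM⟩)

theorem mem_available {n m : ℕ} {h : History n m} {N : Finset (Fin m)} {v : Fin m} :
    v ∈ available h N ↔ v ∈ N ∧ ∀ e ∈ h, e.2 ≠ some v := Finset.mem_filter

theorem available_core_subset {p N : ℕ} (h : History (p + N) (p + N)) {i : Fin (p + N)}
    (hi : i.val < p) : available h (core p N) ⊆ available h (coreItem p N i).2 := by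
  intro v hv
  rw [mem_available] at hv ⊢
  refine ⟨?_, hv.2⟩
  have := hv.1
  simp only [core, Finset.mem_filter, Finset.mem_univ, true_and] at this
  simp [coreItem, coreInstance, hi, this]

theorem card_available_sdiff_core_le {p N : ℕ} (h : History (p + N) (p + N)) (i : Fin (p + N)) :
    (available h (coreItem p N i).2 \ available h (core p N)).card ≤ 1 := by
  refine (Finset.card_le_card (t := {i}) ?_).trans_eq (Finset.card_singleton i)
  intro v hv
  rw [Finset.mem_sdiff, mem_available, mem_available] at hv
  obtain ⟨⟨h1, h2⟩, h3⟩ := hv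
  simp only [coreItem, coreInstance, core, Finset.mem_filter, Finset.mem_univ, true_and] at h1 h3
  rcases h1 with rfl | h1
  · simp
  · exact absurd ⟨h1.2, h2⟩ h3

theorem available_private {p N : ℕ} (h : History (p + N) (p + N)) {i : Fin (p + N)}
    (hi : ¬ i.val < p) :
    available h (coreItem p N i).2 = if i ∈ available h (core p N) then {i} else ∅ := by
  ext v
  split_ifs with hc
  · rw [mem_available] at hc
    rw [mem_available, Finset.mem_singleton]
    simp only [coreItem, coreInstance, Finset.mem_filter, Finset.mem_univ, true_and, hi, false_and,
      or_false]
    exact ⟨fun hv => hv.1, fun hv => ⟨hv, hv ▸ hc.2⟩⟩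
  · rw [mem_available] at hc ⊢
    simp only [coreItem, coreInstance, core, Finset.mem_filter, Finset.mem_univ, true_and, hi,
      false_and, or_false, Finset.notMem_empty, iff_false] at hc ⊢
    rintro ⟨rfl, h2⟩
    exact hc ⟨by omega, h2⟩

/-! ### The bound by the potential -/

/-- If the extra element is missing, padding the average with the larger value `y` only raises it.
Thus one bound serves whether or not a common vertex's own neighbour is free. -/
theorem average_le {α : Type*} [DecidableEq α] {A F : Finset α} (hFA : F ⊆ A)
    (hcard : (A \ F).card ≤ 1) (hA : A.Nonempty) {G : α → ℝ} {x y : ℝ} (hxy : x ≤ y)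
    (hx : ∀ v ∈ F, G v ≤ x) (hy : ∀ v ∈ A \ F, G v ≤ y) :
    (∑ v ∈ A, G v) / A.card ≤ (F.card * x + y) / (F.card + 1) := by
  have h1 : ∑ v ∈ A, G v ≤ F.card * x + (A \ F).card * y := by
    rw [← Finset.sum_sdiff hFA, add_comm]
    refine add_le_add ?_ ?_
    · simpa using Finset.sum_le_card_nsmul F G x hx
    · simpa using Finset.sum_le_card_nsmul (A \ F) G y hy
  have h2 : A.card = F.card + (A \ F).card := by
    rw [Finset.card_sdiff_of_subset hFA]
    have := Finset.card_le_card hFA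
    omega
  have h3 : (0 : ℝ) < A.card := by exact_mod_cast hA.card_pos
  rw [h2] at h3 ⊢
  have hF : (0 : ℝ) ≤ F.card := Nat.cast_nonneg _
  obtain h0 | h0 : (A \ F).card = 0 ∨ (A \ F).card = 1 := by omega
  · rw [h0] at h1 h3 ⊢
    push_cast at h1 h3 ⊢
    rw [div_le_div_iff₀ h3 (by linarith)]
    nlinarith
  · rw [h0] at h1 h3 ⊢
    push_cast at h1 h3 ⊢
    gcongr
    linarith

/-- Induction on the number of arrivals left. The history is arbitrary and need not be consistent
with `s`; injectivity of `s` is all that the drift estimate requires. -/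
theorem totalMatched_le {p N : ℕ} {k c : ℝ} (hc : 0 ≤ c) (hN : (N : ℝ) / 2 ≤ c * k)
    {K : ℕ} (s : Fin K → Fin (p + N)) (hs : s.Injective) (h : History (p + N) (p + N)) :
    totalMatched (fun t => coreItem p N (s t)) h ≤
      K.factorial * (matchedCount h + commonCount p N s +
        potential k c (commonCount p N s) (available h (core p N)).card) := by
  induction K generalizing h with
  | zero =>
    rw [totalMatched_zero, Nat.factorial_zero, Nat.cast_one, one_mul, add_assoc]
    exact le_add_of_nonneg_right (add_nonneg (Nat.cast_nonneg _) (potential_nonneg hc _ _))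
  | succ K ih =>
    set F := available h (core p N) with hF
    set a := commonCount p N s with ha
    set f := F.card with hf
    have hfN : f ≤ N := (Finset.card_filter_le _ _).trans_eq (card_core p N)
    have hfact : (0 : ℝ) ≤ K.factorial := Nat.cast_nonneg _
    have hsplit (t : Fin (K + 1)) :
        (if (s t).val < p then 1 else 0) + commonCount p N (removeAt s t) = a :=
      sum_removeAt s t fun i => if i.val < p then 1 else 0
    -- Potential terms after a common arrival (`U`), a matched private one (`X`, counting the match)
    -- and an unmatched private one (`B`). The truncated subtractions are harmless: `U` gets weight
    -- zero if a = 0, and no private vertex is matched if f = 0.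
    let U : ℝ := (f * potential k c (a - 1) (f - 1) + potential k c (a - 1) f) / (f + 1)
    let X : ℝ := 1 + potential k c a (f - 1)
    let B : ℝ := potential k c a f
    have hmono (b : ℕ) : potential k c b (f - 1) ≤ potential k c b f := by
      rcases Nat.eq_zero_or_pos f with h0 | h0
      · rw [h0]
      · have := potential_mono (k := k) hc b (f - 1)
        rwa [Nat.sub_add_cancel h0] at this
    have herase (t : Fin (K + 1)) (v) (hv : v ∈ F) :
        (available (h ++ [(coreItem p N (s t), some v)]) (core p N)).card = f - 1 := by
      rw [available_append_some, Finset.card_erase_of_mem hv]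
    have herase' (t : Fin (K + 1)) (v) (hv : v ∉ F) :
        (available (h ++ [(coreItem p N (s t), some v)]) (core p N)).card = f := by
      rw [available_append_some, Finset.erase_eq_of_notMem hv]
    have key (t : Fin (K + 1)) :
        (if (available h (coreItem p N (s t)).2).Nonempty then
          (∑ v ∈ available h (coreItem p N (s t)).2,
            totalMatched (fun i => coreItem p N (removeAt s t i))
              (h ++ [(coreItem p N (s t), some v)])) / (available h (coreItem p N (s t)).2).card
        else totalMatched (fun i => coreItem p N (removeAt s t i))
          (h ++ [(coreItem p N (s t), none)])) ≤
        K.factorial * (matchedCount h + a +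
          (if (s t).val < p then U else if s t ∈ F then X else B)) := by
      have IH := fun h' => ih (removeAt s t) (removeAt_injective hs t) h'
      have hst := hsplit t
      by_cases ht : (s t).val < p
      · rw [if_pos ht] at hst
        have hcc : commonCount p N (removeAt s t) = a - 1 := by omega
        have hca : (a : ℝ) = (a - 1 : ℕ) + 1 := by
          rw [← hst]; push_cast; simp; ring
        rw [hcc] at IH
        rw [if_pos ht]
        have hsub := available_core_subset h ht
        split_ifs with hne
        · have := average_le hsub (card_available_sdiff_core_le h (s t)) hne
            (G := fun v => totalMatched (fun i => coreItem p N (removeAt s t i))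
              (h ++ [(coreItem p N (s t), some v)]))
            (x := K.factorial * (matchedCount h + a + potential k c (a - 1) (f - 1)))
            (y := K.factorial * (matchedCount h + a + potential k c (a - 1) f))
            (by gcongr; exact hmono _)
            (fun v hv => by
              refine (IH _).trans (le_of_eq ?_)
              rw [herase t v hv, matchedCount_append_some, hca]
              push_cast
              ring)
            (fun v hv => by
              refine (IH _).trans (le_of_eq ?_)
              rw [herase' t v (Finset.mem_sdiff.1 hv).2, matchedCount_append_some, hca]
              push_cast
              ring)
          refine this.trans (le_of_eq ?_)
          have : ((f : ℝ) + 1) ≠ 0 := by positivity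
          simp only [U]
          field_simp
          ring
        · have hF0 : F = ∅ := by
            rw [Finset.not_nonempty_iff_eq_empty] at hne
            exact Finset.subset_empty.1 (hne ▸ hsub)
          have hf0 : f = 0 := by rw [hf, hF0, Finset.card_empty]
          refine (IH _).trans ?_
          rw [matchedCount_append_none, available_append_none, ← hF, ← hf, hca]
          gcongr
          · linarith
          · simp [U, hf0, potential_zero_right hc]
      · rw [if_neg ht, zero_add] at hst
        rw [hst] at IH
        rw [if_neg ht, available_private h ht]
        by_cases hm : s t ∈ F
        · rw [if_pos hm, if_pos hm, if_pos (Finset.singleton_nonempty _), Finset.sum_singleton,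
            Finset.card_singleton, Nat.cast_one, div_one]
          refine (IH _).trans (le_of_eq ?_)
          rw [herase t _ hm, matchedCount_append_some]
          push_cast
          ring
        · rw [if_neg hm, if_neg hm, if_neg Finset.not_nonempty_empty]
          refine (IH _).trans (le_of_eq ?_)
          rw [matchedCount_append_none, available_append_none]
    have hsum : ∑ t, (if (s t).val < p then U else if s t ∈ F then X else B) ≤ (K + 1) * B := by
      let g : ℕ := (Finset.univ.filter fun t => ¬ (s t).val < p ∧ s t ∈ F).card
      -- Distinct private vertices use distinct core vertices.
      have hgf : g ≤ f :=
        Finset.card_le_card_of_injOn s (fun t ht => (Finset.mem_filter.1 ht).2.2) hs.injOn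
      have h1 : ∑ t, (if (s t).val < p then U else if s t ∈ F then X else B) =
          a * (U - B) + g * (X - B) + (K + 1) * B := by
        have e (t : Fin (K + 1)) : (if (s t).val < p then U else if s t ∈ F then X else B) =
            ((if (s t).val < p then 1 else 0 : ℕ) : ℝ) * (U - B) +
            (if ¬ (s t).val < p ∧ s t ∈ F then 1 else 0) * (X - B) + B := by
          split_ifs <;> first | (exfalso; tauto) | (push_cast; ring)
        simp_rw [e]
        rw [Finset.sum_add_distrib, Finset.sum_add_distrib, ← Finset.sum_mul, ← Finset.sum_mul,
          ← Nat.cast_sum, Finset.sum_boole (fun t => ¬ (s t).val < p ∧ s t ∈ F), Finset.sum_const, Finset.card_univ, Fintype.card_fin,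
          nsmul_eq_mul, Nat.cast_add, Nat.cast_one]
        rfl
      rw [h1]
      suffices (a : ℝ) * (U - B) + g * (X - B) ≤ 0 by linarith
      rcases Nat.eq_zero_or_pos f with h0 | h0
      · have hg0 : g = 0 := by omega
        simp [U, B, h0, hg0, potential_zero_right hc]
      · obtain ⟨f', hf'⟩ := Nat.exists_eq_succ_of_ne_zero h0.ne'
        have hf'N : ((f' : ℝ) + 1) / 2 ≤ c * k := by
          have : ((f' + 1 : ℕ) : ℝ) ≤ N := by exact_mod_cast hf' ▸ hfN
          push_cast at this
          linarith
        -- With no common vertex left the potential is exactly `f`, so each match is paid for by the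
        -- core vertex it uses.
        rcases Nat.eq_zero_or_pos a with a0 | a0
        · have hB : B = f' + 1 := by
            simp only [B, a0, hf']
            rw [potential_zero_left hc (by push_cast; exact hf'N)]
            push_cast
            ring
          have hX : X ≤ f' + 1 := by
            have := potential_le_natCast k c a (f - 1)
            rw [hf', Nat.succ_sub_one] at this
            simp only [X]
            rw [hf', Nat.succ_sub_one]
            linarith
          rw [a0, Nat.cast_zero, zero_mul, zero_add]
          exact mul_nonpos_of_nonneg_of_nonpos (Nat.cast_nonneg g) (by linarith)
        · obtain ⟨a', ha'⟩ := Nat.exists_eq_succ_of_ne_zero a0.ne'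
          have hstep := potential_step (a := a') hc hf'N (hf' ▸ hgf)
          have hU : U = ((f' + 1) * potential k c a' f' + potential k c a' (f' + 1)) /
              ((f' : ℝ) + 2) := by
            simp only [U, hf', ha', Nat.succ_sub_one, Nat.succ_eq_add_one]
            push_cast
            ring_nf
          have hX : X = 1 + potential k c (a' + 1) f' := by
            simp only [X, hf', ha', Nat.succ_sub_one, Nat.succ_eq_add_one]
          have hB : B = potential k c (a' + 1) (f' + 1) := by
            simp only [B, hf', ha', Nat.succ_eq_add_one]
          rw [hU, hX, hB, ha']
          push_cast
          linarith
    rw [totalMatched_succ]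
    refine (Finset.sum_le_sum fun t _ => key t).trans ?_
    rw [← Finset.mul_sum, Finset.sum_add_distrib, Finset.sum_const, Finset.card_univ,
      Fintype.card_fin, nsmul_eq_mul, Nat.factorial_succ]
    push_cast
    have := mul_le_mul_of_nonneg_left hsum hfact
    linarith

/-! ### The asymptotic ratio -/

theorem sum_expectedMatched_coreInstance_le {p N : ℕ} {k c : ℝ} (hc : 0 ≤ c)
    (hN : (N : ℝ) / 2 ≤ c * k) :
    (∑ σ : Equiv.Perm (Fin (p + N)), expectedMatched ((coreInstance p N).arrivals σ) []) /
      (p + N).factorial ≤ p + potential k c p N := by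
  have h := totalMatched_le hc hN (fun i : Fin (p + N) => i) (fun _ _ h => h) []
  have hav : available ([] : History (p + N) (p + N)) (core p N) = core p N := by
    simp [available]
  rw [hav, card_core, commonCount_id] at h
  rw [div_le_iff₀ (by exact_mod_cast (p + N).factorial_pos), mul_comm]
  refine le_trans (le_of_eq ?_) (h.trans (le_of_eq ?_))
  · rfl
  · simp [matchedCount]

theorem romValue_coreInstance_le (p N : ℕ) {k c : ℝ} (hc : 0 ≤ c) (hN : (N : ℝ) / 2 ≤ c * k) :
    random.romValue (coreInstance p N) ≤ ENNReal.ofReal (p + potential k c p N) := by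
  rw [romValue_random]
  exact ENNReal.ofReal_le_ofReal (sum_expectedMatched_coreInstance_le hc hN)

/-- With N = L³, k = L² and c = L/2, the product c·k is exactly N/2. The surplus 1 + L² of common
vertices makes the initial excess vanish, and the harmonic term costs only O(L²). -/
theorem potential_balanced_le {L : ℕ} (hL : 0 < L) :
    potential (L ^ 2 : ℕ) (L / 2) (L ^ 3 + 1 + L ^ 2) (L ^ 3) ≤ L ^ 3 / 2 + L / 2 * (1 + 3 * L) := by
  have hL' : (0 : ℝ) < L := by exact_mod_cast hL
  refine (min_le_right _ _).trans ?_
  unfold potentialAux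
  have h1 : max (((L ^ 3 : ℕ) : ℝ) + 1 - (L ^ 3 + 1 + L ^ 2 : ℕ) + (L ^ 2 : ℕ)) 0 = 0 := by
    push_cast
    rw [max_eq_right]
    linarith
  have h2 : (harmonic (L ^ 3) : ℝ) ≤ 1 + 3 * L := by
    refine (harmonic_le_one_add_log _).trans ?_
    push_cast
    rw [Real.log_pow]
    have := Real.log_le_self hL'.le
    push_cast
    linarith
  rw [h1, zero_add]
  push_cast
  gcongr

theorem ratio_coreInstance_le {L : ℕ} (hL : 0 < L) :
    random.romValue (coreInstance (L ^ 3 + 1 + L ^ 2) (L ^ 3)) /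
      ((coreInstance (L ^ 3 + 1 + L ^ 2) (L ^ 3)).opt : ℝ≥0∞) ≤
      ENNReal.ofReal (3 / 4 + 2 / L) := by
  have hL' : (1 : ℝ) ≤ L := by exact_mod_cast hL
  set p := L ^ 3 + 1 + L ^ 2 with hp
  have hopt : ((p + L ^ 3 : ℕ) : ℝ≥0∞) ≤ (coreInstance p (L ^ 3)).opt := by
    exact_mod_cast le_opt_coreInstance p (L ^ 3)
  refine (ENNReal.div_le_div (romValue_coreInstance_le p (L ^ 3) (k := (L ^ 2 : ℕ))
    (c := L / 2) (by positivity) (by push_cast; apply le_of_eq; ring)) hopt).trans ?_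
  have hpos : (0 : ℝ) < (p + L ^ 3 : ℕ) := by rw [hp]; positivity
  rw [← ENNReal.ofReal_natCast, ← ENNReal.ofReal_div_of_pos hpos]
  refine ENNReal.ofReal_le_ofReal ?_
  rw [div_le_iff₀ hpos]
  have h := potential_balanced_le hL
  rw [← hp] at h
  have e1 : (p : ℝ) = L ^ 3 + 1 + L ^ 2 := by rw [hp]; push_cast; ring
  have e2 : (3 / 4 + 2 / (L : ℝ)) * (p + L ^ 3 : ℕ) =
      3 / 4 * (2 * L ^ 3 + 1 + L ^ 2) + (4 * L ^ 2 + 2 / L + 2 * L) := by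
    push_cast
    rw [e1]
    field_simp
    ring
  rw [e2]
  have h3 : 0 ≤ 2 / (L : ℝ) := by positivity
  nlinarith

theorem romAsymptoticRatio_random_le : random.romAsymptoticRatio ≤ 3 / 4 := by
  have hlim : Filter.Tendsto (fun L : ℕ => ENNReal.ofReal (3 / 4 + 2 / L)) Filter.atTop
      (nhds (ENNReal.ofReal (3 / 4 + 0))) :=
    ENNReal.tendsto_ofReal (tendsto_const_nhds.add (tendsto_const_div_atTop_nhds_zero_nat 2))
  have h34 : ENNReal.ofReal (3 / 4 + 0) = 3 / 4 := by
    rw [add_zero, ENNReal.ofReal_div_of_pos (by norm_num)]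
    norm_num
  rw [h34] at hlim
  refine le_of_forall_gt fun x hx => ?_
  obtain ⟨y, hy, hyx⟩ := exists_between hx
  refine lt_of_le_of_lt ?_ hyx
  -- For the limit inferior, the sparse sizes 2L³ + L² + 1 suffice.
  refine Filter.liminf_le_of_frequently_le' ?_
  rw [Filter.frequently_atTop]
  intro n
  obtain ⟨L, hLy, hL⟩ := ((hlim.eventually (gt_mem_nhds hy)).and
    (Filter.eventually_gt_atTop n)).exists
  refine ⟨L ^ 3 + 1 + L ^ 2 + L ^ 3, ?_, ?_⟩
  · have := Nat.le_self_pow (n := 3) (by norm_num) L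
    omega
  · have hopt : 0 < (coreInstance (L ^ 3 + 1 + L ^ 2) (L ^ 3)).opt :=
      lt_of_lt_of_le (by omega) (le_opt_coreInstance _ _)
    exact iInf₂_le_of_le (coreInstance (L ^ 3 + 1 + L ^ 2) (L ^ 3)) hopt
      ((ratio_coreInstance_le (by omega)).trans hLy.le)

end OnlineMatching

theorem mainTheorem10 : OnlineMatching.random.romAsymptoticRatio ≤ 3 / 4 := by
  exact OnlineMatching.romAsymptoticRatio_random_le
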